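/- Let $k\ge 1$ and let $\lambda_1,\dots,\lambda_k\ge 0$. A \emph{generalized counting process} (GCP) with intensities $\lambda_1,\dots,\lambda_k$ is a process $\{\mathbb M(t)\}_{t\ge0}$ with values in $\{0,1,2,\dots\}$ and almost surely nondecreasing right-continuous paths, such that $\mathbb M(0)=0$ almost surely, the increments are independent, and for $0\le s\le t$ and $n\ge 0$ \[ \mathbb P\big(\mathbb M(t)-\mathbb M(s)=n\big)=\sum_{\substack{x_1,\dots,x_k\ge 0\\ x_1+2x_2+\cdots+kx_k=n}}\ \prod_{j=1}^k\frac{(\lambda_j(t-s))^{x_j}}{x_j!}e^{-\lambda_j(t-s)} . \] A \emph{generalized Skellam process} (GSP) is $\mathcal S(t)=\mathbb M_1(t)-\mathbb M_2(t)$, where $\mathbb M_1,\mathbb M_2$ are independent GCPs with intensities $\lambda_1,\dots,\lambda_k$ and $\mu_1,\dots,\mu_k$. The \emph{running average} of a process $X$ is $X_A(t)=\frac1t\int_0^tX(u)\,du$ for $t>0$, and $X_A(0)=0$. A square-integrable process $Y$ has the \emph{long-range dependence} (LRD) property if there is $\theta\in(0,1)$ such that for every fixed $s>0$ there is $c(s)>0$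 with $\mathrm{Corr}(Y(s),Y(t))\sim c(s)\,t^{-\theta}$ as $t\to\infty$. (i) Let $\mathcal S$ be a GSP whose intensities $\lambda_1,\dots,\lambda_k,\mu_1,\dots,\mu_k$ are not all zero. Then for $0<s\le t$ \[ \mathrm{Corr}\big(\mathcal S_A(s),\mathcal S_A(t)\big)=\frac{3t-s}{2t}\,\sqrt{s}\,t^{-1/2}, \] and $\{\mathcal S_A(t)\}_{t\ge0}$ has the LRD property. (ii) Let $\mathbb M$ be a GCP whose intensities are not all zero. Then $\mathrm{Corr}(\mathbb M_A(s),\mathbb M_A(t))=\frac{3t-s}{2t}\sqrt{s}\,t^{-1/2}$ for $0<s\le t$, and $\{\mathbb M_A(t)\}_{t\ge0}$ has the LRD property. -/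

import Mathlib

open MeasureTheory ProbabilityTheory Filter Asymptotics
open scoped NNReal

noncomputable section

/-- The law of `∑_{j=1}^k j N_j` for independent Poisson variables `N_j` with means `rate_j * τ`;
the index `i : Fin k` stands for the jump size `j = i + 1`. The mass at `n` is
`∑_{x_1 + 2 x_2 + ⋯ + k x_k = n} ∏_j (rate_j τ)^{x_j} / x_j! * exp (-rate_j τ)`. -/
def gcpLaw {k : ℕ} (rate : Fin k → ℝ≥0) (τ : ℝ≥0) : Measure ℕ :=
  (Measure.pi fun i : Fin k => poissonMeasure (rate i * τ)).map
    fun x : Fin k → ℕ => ∑ i : Fin k, ((i : ℕ) + 1) * x i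

/-- `M` is a generalized counting process (GCP): a counting process with jump sizes `1, …, k`
occurring with intensities `rate_1, …, rate_k`. -/
structure IsGCP {Ω : Type*} [MeasurableSpace Ω] {k : ℕ} (M : ℝ≥0 → Ω → ℕ)
    (rate : Fin k → ℝ≥0) (P : Measure Ω) : Prop where
  measurable : ∀ t, Measurable (M t)
  start : ∀ᵐ ω ∂P, M 0 ω = 0
  paths : ∀ᵐ ω ∂P, Monotone (fun t => M t ω) ∧
    ∀ t, ContinuousWithinAt (fun u => M u ω) (Set.Ici t) t
  indep_increments : HasIndepIncrements (fun t ω => (M t ω : ℝ)) P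
  law_increments : ∀ s t : ℝ≥0, s ≤ t →
    HasLaw (fun ω => (M t ω : ℝ) - (M s ω : ℝ))
      ((gcpLaw rate (t - s)).map (Nat.cast : ℕ → ℝ)) P

/-- `S` is a generalized Skellam process (GSP): the difference of two independent GCPs.
Independence is that of the whole processes. -/
def IsGSP {Ω : Type*} [MeasurableSpace Ω] {k : ℕ} (S : ℝ≥0 → Ω → ℝ)
    (rate₁ rate₂ : Fin k → ℝ≥0) (P : Measure Ω) : Prop :=
  ∃ M₁ M₂ : ℝ≥0 → Ω → ℕ, IsGCP M₁ rate₁ P ∧ IsGCP M₂ rate₂ P ∧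
    IndepFun (fun ω t => M₁ t ω) (fun ω t => M₂ t ω) P ∧
    ∀ t ω, S t ω = (M₁ t ω : ℝ) - (M₂ t ω : ℝ)

/-- The running average `X_A(t) = (1/t) ∫₀ᵗ X(u) du`, with `X_A(0) = 0`. -/
def runningAverage {Ω : Type*} (X : ℝ≥0 → Ω → ℝ) (t : ℝ≥0) (ω : Ω) : ℝ :=
  (1 / (t : ℝ)) * ∫ u in (0 : ℝ)..(t : ℝ), X u.toNNReal ω

/-- Correlation coefficient of two real random variables. -/
def corr {Ω : Type*} [MeasurableSpace Ω] (X Y : Ω → ℝ) (P : Measure Ω) : ℝ :=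
  covariance X Y P / (√(variance X P) * √(variance Y P))

/-- Long-range dependence of a square-integrable process: for some `θ ∈ (0, 1)` and every fixed
`s > 0`, `Corr(Y(s), Y(t)) ~ c(s) t^{-θ}` as `t → ∞`, with `c(s) > 0`. -/
def HasLRD {Ω : Type*} [MeasurableSpace Ω] (Y : ℝ≥0 → Ω → ℝ) (P : Measure Ω) : Prop :=
  (∀ t, MemLp (Y t) 2 P) ∧
  ∃ θ : ℝ, 0 < θ ∧ θ < 1 ∧ ∀ s : ℝ≥0, 0 < s → ∃ c : ℝ, 0 < c ∧
    (fun t : ℝ≥0 => corr (Y s) (Y t) P) ~[atTop] (fun t : ℝ≥0 => c * (t : ℝ) ^ (-θ))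

end

/-!
A GCP or GSP `X` satisfies `Cov(X(s), X(t)) = κ min(s, t)`, where `κ` is the variance of `X(1)`:
the increment `X(t) - X(s)` is uncorrelated with `X(s)`, and for a GSP the covariances of its two
independent GCPs add up. By Fubini's theorem the covariance of `X_A(s)` and `X_A(t)` is the average
of `κ min(u, v)` over `[0, s] × [0, t]`, that is `κ s (3t - s) / (6t)` for `s ≤ t`. The factor `κ`
cancels in the correlation, and since `(3t - s) / (2t) → 3/2`, the running average has long-range
dependence with exponent `θ = 1/2` and `c(s) = (3/2) √s`.
-/

open scoped Topology

section Poisson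

lemma hasSum_descFactorial_poisson (r : ℝ≥0) (m : ℕ) :
    HasSum (fun n : ℕ => Real.exp (-r) * (r : ℝ) ^ n / n.factorial * (n.descFactorial m : ℝ))
      ((r : ℝ) ^ m) := by
  have initial_terms : ∑ n ∈ Finset.range m,
      Real.exp (-r) * (r : ℝ) ^ n / n.factorial * (n.descFactorial m : ℝ) = 0 :=
    Finset.sum_eq_zero fun n hn => by
      rw [Nat.descFactorial_of_lt (Finset.mem_range.mp hn), Nat.cast_zero, mul_zero]
  rw [← hasSum_nat_add_iff' m, initial_terms, sub_zero]
  have shifted := (hasSum_one_poissonMeasure r).mul_left ((r : ℝ) ^ m)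
  rw [mul_one] at shifted
  refine shifted.congr_fun fun n => ?_
  have factorial_eq :
      ((n + m).factorial : ℝ) = n.factorial * ((n + m).descFactorial m : ℝ) := by
    exact_mod_cast (by simpa using (Nat.factorial_mul_descFactorial (Nat.le_add_left m n)).symm)
  have descFactorial_ne_zero : ((n + m).descFactorial m : ℝ) ≠ 0 :=
    right_ne_zero_of_mul (factorial_eq ▸ Nat.cast_ne_zero.mpr (n + m).factorial_ne_zero)
  rw [factorial_eq]
  field_simp
  ring

lemma integrable_descFactorial_poissonMeasure (r : ℝ≥0) (m : ℕ) :
    Integrable (fun n : ℕ => (n.descFactorial m : ℝ)) (poissonMeasure r) := by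
  rw [integrable_poissonMeasure_iff]
  simpa using (hasSum_descFactorial_poisson r m).summable

lemma integral_descFactorial_poissonMeasure (r : ℝ≥0) (m : ℕ) :
    ∫ n, (n.descFactorial m : ℝ) ∂(poissonMeasure r) = (r : ℝ) ^ m := by
  rw [integral_poissonMeasure]
  exact (hasSum_descFactorial_poisson r m).tsum_eq

lemma natCast_sq_eq_descFactorial_two_add_one (n : ℕ) :
    (n : ℝ) ^ 2 = n.descFactorial 2 + n.descFactorial 1 := by
  rw [Nat.cast_descFactorial_two, Nat.descFactorial_one]
  ring

lemma memLp_natCast_poissonMeasure (r : ℝ≥0) :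
    MemLp (fun n : ℕ => (n : ℝ)) 2 (poissonMeasure r) := by
  rw [memLp_two_iff_integrable_sq .of_discrete]
  simp only [natCast_sq_eq_descFactorial_two_add_one]
  exact (integrable_descFactorial_poissonMeasure r 2).add
    (integrable_descFactorial_poissonMeasure r 1)

lemma variance_natCast_poissonMeasure (r : ℝ≥0) :
    Var[fun n : ℕ => (n : ℝ); poissonMeasure r] = r := by
  have mean : ∫ n, (n : ℝ) ∂(poissonMeasure r) = r := by
    simpa using integral_descFactorial_poissonMeasure r 1
  have second_moment : ∫ n, (n : ℝ) ^ 2 ∂(poissonMeasure r) = (r : ℝ) ^ 2 + r := by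
    simp only [natCast_sq_eq_descFactorial_two_add_one]
    rw [integral_add (integrable_descFactorial_poissonMeasure r 2)
      (integrable_descFactorial_poissonMeasure r 1), integral_descFactorial_poissonMeasure,
      integral_descFactorial_poissonMeasure, pow_one]
  rw [variance_eq_sub (memLp_natCast_poissonMeasure r), mean]
  simp only [Pi.pow_apply, second_moment, add_sub_cancel_left]

variable {ι : Type*} [Fintype ι] (c : ι → ℝ) (r : ι → ℝ≥0)

lemma memLp_sum_mul_pi_poissonMeasure :
    MemLp (fun x : ι → ℕ => ∑ i, c i * (x i : ℝ)) 2
      (Measure.pi fun i => poissonMeasure (r i)) :=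
  memLp_finsetSum _ fun i _ =>
    ((memLp_natCast_poissonMeasure (r i)).const_mul (c i)).comp_measurePreserving
      (measurePreserving_eval (fun i => poissonMeasure (r i)) i)

lemma variance_sum_mul_pi_poissonMeasure :
    Var[fun x : ι → ℕ => ∑ i, c i * (x i : ℝ); Measure.pi fun i => poissonMeasure (r i)] =
      ∑ i, c i ^ 2 * r i := by
  have variance_sum := variance_sum_pi (μ := fun i => poissonMeasure (r i))
    (X := fun i (n : ℕ) => c i * (n : ℝ))
    fun i => (memLp_natCast_poissonMeasure (r i)).const_mul (c i)
  simpa only [Finset.sum_fn, variance_const_mul, variance_natCast_poissonMeasure]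
    using variance_sum

end Poisson

section SquareIntegrable

variable {Ω α β : Type*} [MeasurableSpace Ω] [MeasurableSpace α] [MeasurableSpace β]
  {P : Measure Ω} {ν : Measure α} {ν' : Measure β} {X : α → Ω → ℝ} {Y : β → Ω → ℝ}

lemma ae_memLp_two_of_memLp_two_prod [SFinite P] [SFinite ν]
    (hX : MemLp (fun p : Ω × α => X p.2 p.1) 2 (P.prod ν)) :
    ∀ᵐ a ∂ν, MemLp (X a) 2 P := by
  filter_upwards [hX.1.prodMk_right, hX.integrable_sq.prod_left_ae] with a hmeas hint
  exact (memLp_two_iff_integrable_sq hmeas).mpr hint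

variable [IsFiniteMeasure ν] [IsFiniteMeasure ν']

lemma integrable_mul_of_memLp_two_prod [SFinite P]
    (hX : MemLp (fun p : Ω × α => X p.2 p.1) 2 (P.prod ν))
    (hY : MemLp (fun p : Ω × β => Y p.2 p.1) 2 (P.prod ν')) :
    Integrable (fun p : Ω × α × β => X p.2.1 p.1 * Y p.2.2 p.1) (P.prod (ν.prod ν')) := by
  have assoc : MeasurePreserving MeasurableEquiv.prodAssoc ((P.prod ν).prod ν')
      (P.prod (ν.prod ν')) := ⟨MeasurableEquiv.measurable _, Measure.prodAssoc_prod⟩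
  have assoc' : MeasurePreserving MeasurableEquiv.prodAssoc ((P.prod ν').prod ν)
      (P.prod (ν'.prod ν)) := ⟨MeasurableEquiv.measurable _, Measure.prodAssoc_prod⟩
  have hX' := (hX.comp_fst ν').comp_measurePreserving assoc.symm
  have hY' := (hY.comp_fst ν).comp_measurePreserving
    (assoc'.symm.comp ((MeasurePreserving.id P).prod Measure.measurePreserving_swap))
  exact hX'.integrable_mul hY'

lemma memLp_two_integral [SFinite P]
    (hX : MemLp (fun p : Ω × α => X p.2 p.1) 2 (P.prod ν)) :
    MemLp (fun ω => ∫ a, X a ω ∂ν) 2 P := by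
  -- The square of `∫ X a` is the integral of `X a * X b` over the product measure.
  rw [memLp_two_iff_integrable_sq hX.1.integral_prod_right']
  refine (integrable_mul_of_memLp_two_prod hX hX).integral_prod_left.congr (ae_of_all _ fun ω => ?_)
  simp only [sq]
  exact integral_prod_mul (X · ω) (X · ω)

lemma covariance_integral_integral [IsProbabilityMeasure P]
    (hX : MemLp (fun p : Ω × α => X p.2 p.1) 2 (P.prod ν))
    (hY : MemLp (fun p : Ω × β => Y p.2 p.1) 2 (P.prod ν')) :
    cov[fun ω => ∫ a, X a ω ∂ν, fun ω => ∫ b, Y b ω ∂ν'; P] =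
      ∫ a, ∫ b, cov[X a, Y b; P] ∂ν' ∂ν := by
  have hX₁ := hX.integrable one_le_two
  have hY₁ := hY.integrable one_le_two
  have hXY := integrable_mul_of_memLp_two_prod hX hY
  have second_moment : ∫ ω, (∫ a, X a ω ∂ν) * ∫ b, Y b ω ∂ν' ∂P =
      ∫ q : α × β, ∫ ω, X q.1 ω * Y q.2 ω ∂P ∂(ν.prod ν') := by
    rw [← integral_integral_swap (f := fun ω (q : α × β) => X q.1 ω * Y q.2 ω) hXY]
    exact integral_congr_ae (ae_of_all _ fun ω => (integral_prod_mul (X · ω) (Y · ω)).symm)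
  have mean_mul_mean : (∫ ω, ∫ a, X a ω ∂ν ∂P) * ∫ ω, ∫ b, Y b ω ∂ν' ∂P =
      ∫ q : α × β, (∫ ω, X q.1 ω ∂P) * ∫ ω, Y q.2 ω ∂P ∂(ν.prod ν') := by
    rw [integral_integral_swap (f := fun ω a => X a ω) hX₁,
      integral_integral_swap (f := fun ω b => Y b ω) hY₁]
    exact (integral_prod_mul (fun a => ∫ ω, X a ω ∂P) (fun b => ∫ ω, Y b ω ∂P)).symm
  have integrable_second_moment := hXY.integral_prod_right
  have integrable_mean_mul_mean := hX₁.integral_prod_right.mul_prod hY₁.integral_prod_right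
  have covariance_ae_eq : (fun q : α × β => cov[X q.1, Y q.2; P]) =ᵐ[ν.prod ν'] fun q =>
      ∫ ω, X q.1 ω * Y q.2 ω ∂P - (∫ ω, X q.1 ω ∂P) * ∫ ω, Y q.2 ω ∂P := by
    filter_upwards [Measure.quasiMeasurePreserving_fst.ae (ae_memLp_two_of_memLp_two_prod hX),
      Measure.quasiMeasurePreserving_snd.ae (ae_memLp_two_of_memLp_two_prod hY)] with q hXq hYq
    exact covariance_eq_sub hXq hYq
  calc cov[fun ω => ∫ a, X a ω ∂ν, fun ω => ∫ b, Y b ω ∂ν'; P]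
    _ = ∫ ω, (∫ a, X a ω ∂ν) * ∫ b, Y b ω ∂ν' ∂P -
        (∫ ω, ∫ a, X a ω ∂ν ∂P) * ∫ ω, ∫ b, Y b ω ∂ν' ∂P :=
      covariance_eq_sub (memLp_two_integral hX) (memLp_two_integral hY)
    _ = ∫ q : α × β, cov[X q.1, Y q.2; P] ∂(ν.prod ν') := by
      rw [second_moment, mean_mul_mean, integral_congr_ae covariance_ae_eq]
      exact (integral_sub integrable_second_moment integrable_mean_mul_mean).symm
    _ = ∫ a, ∫ b, cov[X a, Y b; P] ∂ν' ∂ν :=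
      integral_prod _
        ((integrable_second_moment.sub integrable_mean_mul_mean).congr covariance_ae_eq.symm)

end SquareIntegrable

section RightContinuous

lemma tendsto_ceil_mul_div_nhdsGE {R : Type*} [Field R] [LinearOrder R] [IsStrictOrderedRing R]
    [FloorRing R] [TopologicalSpace R] [OrderTopology R] (x : R) :
    Tendsto (fun r : R => (⌈x * r⌉ : R) / r) atTop (𝓝[≥] x) := by
  have lower : ∀ᶠ r : R in atTop, x ≤ (⌈x * r⌉ : R) / r := by
    filter_upwards [eventually_gt_atTop 0] with r hr
    exact (le_div_iff₀ hr).mpr (Int.le_ceil _)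
  have upper : ∀ᶠ r : R in atTop, (⌈x * r⌉ : R) / r ≤ x + r⁻¹ := by
    filter_upwards [eventually_gt_atTop 0] with r hr
    rw [div_le_iff₀ hr, add_mul, inv_mul_cancel₀ hr.ne']
    exact (Int.ceil_lt_add_one _).le
  have upper_tendsto : Tendsto (fun r : R => x + r⁻¹) atTop (𝓝 x) := by
    simpa using tendsto_inv_atTop_zero.const_add x
  exact tendsto_nhdsWithin_iff.mpr
    ⟨tendsto_of_tendsto_of_tendsto_of_le_of_le' tendsto_const_nhds upper_tendsto lower upper, lower⟩

lemma aestronglyMeasurable_prod_of_continuousWithinAt_Ici {Ω E : Type*} [MeasurableSpace Ω]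
    [TopologicalSpace E] [TopologicalSpace.PseudoMetrizableSpace E] [SecondCountableTopology E]
    [MeasurableSpace E] [BorelSpace E] {P : Measure Ω} {ν : Measure ℝ} {X : ℝ → Ω → E}
    (hX : ∀ t, Measurable (X t))
    (hcont : ∀ᵐ ω ∂P, ∀ t, ContinuousWithinAt (X · ω) (Set.Ici t) t) :
    AEStronglyMeasurable (fun p : Ω × ℝ => X p.2 p.1) (P.prod ν) := by
  refine aestronglyMeasurable_of_tendsto_ae (u := (atTop : Filter ℕ))
    (f := fun n p => X (⌈p.2 * (n : ℝ)⌉ / n) p.1) (fun n => ?_) ?_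
  · have grid_measurable : Measurable fun q : Ω × ℤ => X (q.2 / n) q.1 :=
      measurable_from_prod_countable_left fun j => hX (j / n)
    exact (grid_measurable.comp
      (measurable_fst.prodMk (measurable_snd.mul_const _).ceil)).aestronglyMeasurable
  · filter_upwards [Measure.quasiMeasurePreserving_fst.ae hcont] with p hp
    exact (hp p.2).tendsto.comp
      ((tendsto_ceil_mul_div_nhdsGE p.2).comp tendsto_natCast_atTop_atTop)

end RightContinuous

lemma covariance_eq_variance_min_of_hasIndepIncrements {Ω T : Type*} [MeasurableSpace Ω]
    {P : Measure Ω} [IsFiniteMeasure P] [LinearOrder T] [OrderBot T] {X : T → Ω → ℝ}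
    (hX : HasIndepIncrements X P) (hX₀ : ∀ᵐ ω ∂P, X ⊥ ω = 0) (hX₂ : ∀ t, MemLp (X t) 2 P)
    (s t : T) : cov[X s, X t; P] = Var[X (min s t); P] := by
  wlog hst : s ≤ t generalizing s t
  · rw [covariance_comm, min_comm, this t s (le_of_not_ge hst)]
  have increment_uncorrelated : cov[X s, X t - X s; P] = 0 :=
    (hX.indepFun_eval_sub bot_le hst hX₀).covariance_eq_zero (hX₂ s) ((hX₂ t).sub (hX₂ s))
  rw [covariance_sub_right (hX₂ s) (hX₂ t) (hX₂ s), sub_eq_zero] at increment_uncorrelated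
  rw [increment_uncorrelated, covariance_self (hX₂ s).aemeasurable, min_eq_left hst]

section Min

lemma integral_min_of_mem_Icc {u t : ℝ} (hu : u ∈ Set.Icc 0 t) :
    ∫ v in (0 : ℝ)..t, min u v = u * t - u ^ 2 / 2 := by
  have min_continuous : Continuous fun v : ℝ => min u v := by fun_prop
  have below : ∫ v in (0 : ℝ)..u, min u v = ∫ v in (0 : ℝ)..u, v :=
    intervalIntegral.integral_congr fun v hv => min_eq_right (Set.uIcc_of_le hu.1 ▸ hv).2
  have above : ∫ v in u..t, min u v = ∫ _ in u..t, u :=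
    intervalIntegral.integral_congr fun v hv => min_eq_left (Set.uIcc_of_le hu.2 ▸ hv).1
  rw [← intervalIntegral.integral_add_adjacent_intervals
    (min_continuous.intervalIntegrable 0 u) (min_continuous.intervalIntegrable u t), below, above,
    integral_id, intervalIntegral.integral_const, smul_eq_mul]
  ring

lemma integral_integral_min {s t : ℝ} (hs : 0 ≤ s) (hst : s ≤ t) :
    ∫ u in (0 : ℝ)..s, ∫ v in (0 : ℝ)..t, min u v = s ^ 2 * (3 * t - s) / 6 := by
  calc ∫ u in (0 : ℝ)..s, ∫ v in (0 : ℝ)..t, min u v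
    _ = ∫ u in (0 : ℝ)..s, (u * t - u ^ 2 / 2) :=
      intervalIntegral.integral_congr fun u hu => by
        rw [Set.uIcc_of_le hs] at hu
        exact integral_min_of_mem_Icc ⟨hu.1, hu.2.trans hst⟩
    _ = s ^ 2 * (3 * t - s) / 6 := by
      rw [intervalIntegral.integral_sub (Continuous.intervalIntegrable (by fun_prop) _ _)
          (Continuous.intervalIntegrable (by fun_prop) _ _),
        intervalIntegral.integral_mul_const, intervalIntegral.integral_div, integral_id,
        integral_pow]
      norm_num
      ring

end Min

/-- A jointly measurable, locally square-integrable process with the covariance function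
`κ * min s t` of a square-integrable Lévy process with variance `κ` per unit of time. The process
is extended to negative times by its value at `0`, so that it can be integrated against Lebesgue
measure on `ℝ`, as in `runningAverage`. -/
structure HasMinCovariance {Ω : Type*} [MeasurableSpace Ω] (X : ℝ≥0 → Ω → ℝ) (κ : ℝ)
    (P : Measure Ω) : Prop where
  memLp_two_prod : ∀ t : ℝ≥0,
    MemLp (fun p : Ω × ℝ => X p.2.toNNReal p.1) 2 (P.prod (volume.restrict (Set.Ioc 0 (t : ℝ))))
  covariance_eq : ∀ s t : ℝ≥0, cov[X s, X t; P] = κ * (min s t : ℝ≥0)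

lemma runningAverage_eq_setIntegral {Ω : Type*} (X : ℝ≥0 → Ω → ℝ) (t : ℝ≥0) :
    runningAverage X t =
      fun ω => 1 / (t : ℝ) * ∫ u in Set.Ioc 0 (t : ℝ), X u.toNNReal ω := by
  ext ω
  rw [runningAverage, intervalIntegral.integral_of_le t.coe_nonneg]

lemma tendsto_three_mul_sub_div_two_mul (s : ℝ) :
    Tendsto (fun t : ℝ => (3 * t - s) / (2 * t)) atTop (𝓝 (3 / 2)) := by
  have shifted : Tendsto (fun t : ℝ => 3 / 2 - s / 2 * t⁻¹) atTop (𝓝 (3 / 2)) := by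
    simpa using (tendsto_inv_atTop_zero.const_mul (s / 2)).const_sub (3 / 2 : ℝ)
  refine shifted.congr' ?_
  filter_upwards [eventually_gt_atTop 0] with t ht
  field_simp

namespace HasMinCovariance

variable {Ω : Type*} [MeasurableSpace Ω] {P : Measure Ω} {X : ℝ≥0 → Ω → ℝ} {κ : ℝ}

lemma memLp_runningAverage [SFinite P] (h : HasMinCovariance X κ P) (t : ℝ≥0) :
    MemLp (runningAverage X t) 2 P := by
  rw [runningAverage_eq_setIntegral]
  exact (memLp_two_integral (X := fun u : ℝ => X u.toNNReal) (h.memLp_two_prod t)).const_mul _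

variable [IsProbabilityMeasure P]

lemma covariance_runningAverage (h : HasMinCovariance X κ P) {s t : ℝ≥0} (hs : 0 < s)
    (hst : s ≤ t) :
    cov[runningAverage X s, runningAverage X t; P] = κ * (s * (3 * t - s) / (6 * t)) := by
  have covariance_integral : cov[fun ω => ∫ u in Set.Ioc 0 (s : ℝ), X u.toNNReal ω,
      fun ω => ∫ v in Set.Ioc 0 (t : ℝ), X v.toNNReal ω; P] =
      κ * (s ^ 2 * (3 * t - s) / 6) := by
    rw [covariance_integral_integral (X := fun u : ℝ => X u.toNNReal)
      (Y := fun v : ℝ => X v.toNNReal) (h.memLp_two_prod s) (h.memLp_two_prod t),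
      ← integral_integral_min s.coe_nonneg (NNReal.coe_le_coe.mpr hst),
      intervalIntegral.integral_of_le s.coe_nonneg, ← integral_const_mul]
    refine setIntegral_congr_fun measurableSet_Ioc fun u hu => ?_
    simp only [h.covariance_eq]
    rw [intervalIntegral.integral_of_le t.coe_nonneg, ← integral_const_mul]
    refine setIntegral_congr_fun measurableSet_Ioc fun v hv => ?_
    simp only [NNReal.coe_min, Real.coe_toNNReal u hu.1.le, Real.coe_toNNReal v hv.1.le]
  have hs' : (s : ℝ) ≠ 0 := NNReal.coe_ne_zero.mpr hs.ne'
  have ht' : (t : ℝ) ≠ 0 := NNReal.coe_ne_zero.mpr (hs.trans_le hst).ne'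
  rw [runningAverage_eq_setIntegral, runningAverage_eq_setIntegral, covariance_const_mul_left,
    covariance_const_mul_right, covariance_integral]
  field_simp

lemma variance_runningAverage (h : HasMinCovariance X κ P) {t : ℝ≥0} (ht : 0 < t) :
    Var[runningAverage X t; P] = κ / 3 * t := by
  have ht' : (t : ℝ) ≠ 0 := NNReal.coe_ne_zero.mpr ht.ne'
  rw [← covariance_self (h.memLp_runningAverage t).aemeasurable,
    h.covariance_runningAverage ht le_rfl]
  field_simp
  ring

lemma corr_runningAverage (h : HasMinCovariance X κ P) (hκ : 0 < κ) {s t : ℝ≥0} (hs : 0 < s)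
    (hst : s ≤ t) :
    corr (runningAverage X s) (runningAverage X t) P =
      (3 * (t : ℝ) - s) / (2 * t) * (√(s : ℝ) * (t : ℝ) ^ (-(1 / 2) : ℝ)) := by
  have ht : 0 < t := hs.trans_le hst
  have : 0 < √(s : ℝ) := Real.sqrt_pos.mpr (NNReal.coe_pos.mpr hs)
  have : 0 < √(t : ℝ) := Real.sqrt_pos.mpr (NNReal.coe_pos.mpr ht)
  have : (0 : ℝ) < t := NNReal.coe_pos.mpr ht
  have sqrt_variance_mul : √(κ / 3 * s) * √(κ / 3 * t) = κ / 3 * (√(s : ℝ) * √(t : ℝ)) := by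
    rw [Real.sqrt_mul (by positivity), Real.sqrt_mul (by positivity), mul_mul_mul_comm,
      Real.mul_self_sqrt (by positivity)]
  rw [corr, h.covariance_runningAverage hs hst, h.variance_runningAverage hs,
    h.variance_runningAverage ht, sqrt_variance_mul, Real.rpow_neg t.coe_nonneg,
    ← Real.sqrt_eq_rpow]
  field_simp
  rw [Real.sq_sqrt s.coe_nonneg]
  ring

lemma hasLRD_runningAverage (h : HasMinCovariance X κ P) (hκ : 0 < κ) :
    HasLRD (runningAverage X) P := by
  refine ⟨h.memLp_runningAverage, 1 / 2, by norm_num, by norm_num, fun s hs =>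
    ⟨3 / 2 * √(s : ℝ), by positivity, ?_⟩⟩
  have prefactor : (fun t : ℝ≥0 => (3 * (t : ℝ) - s) / (2 * t)) ~[atTop] fun _ => (3 / 2 : ℝ) :=
    (isEquivalent_const_iff_tendsto (by norm_num)).mpr
      ((tendsto_three_mul_sub_div_two_mul s).comp (NNReal.tendsto_coe_atTop.mpr tendsto_id))
  have corr_eventuallyEq : (fun t => corr (runningAverage X s) (runningAverage X t) P) =ᶠ[atTop]
      fun t : ℝ≥0 => (3 * (t : ℝ) - s) / (2 * t) * (√(s : ℝ) * (t : ℝ) ^ (-(1 / 2) : ℝ)) :=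
    (eventually_ge_atTop s).mono fun t hst => h.corr_runningAverage hκ hs hst
  simp only [mul_assoc]
  exact (prefactor.mul .refl).congr_left corr_eventuallyEq.symm

end HasMinCovariance

/-- The variance per unit of time of a generalized counting process; the index `i : Fin k` stands
for the jump size `i + 1`. -/
def gcpVarianceRate {k : ℕ} (rate : Fin k → ℝ≥0) : ℝ≥0 :=
  ∑ i : Fin k, ((i : ℝ≥0) + 1) ^ 2 * rate i

lemma gcpVarianceRate_pos {k : ℕ} {rate : Fin k → ℝ≥0} (h : ∃ i, 0 < rate i) :
    0 < gcpVarianceRate rate := by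
  obtain ⟨i, hi⟩ := h
  exact Finset.sum_pos' (fun _ _ => zero_le) ⟨i, Finset.mem_univ i, by positivity⟩

section GCPLaw

variable {k : ℕ} (rate : Fin k → ℝ≥0) (τ : ℝ≥0)

lemma memLp_natCast_gcpLaw : MemLp (fun n : ℕ => (n : ℝ)) 2 (gcpLaw rate τ) := by
  rw [gcpLaw, memLp_map_measure_iff .of_discrete .of_discrete]
  simpa [Function.comp_def] using
    memLp_sum_mul_pi_poissonMeasure (fun i : Fin k => (i : ℝ) + 1) (fun i => rate i * τ)

lemma variance_natCast_gcpLaw :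
    Var[fun n : ℕ => (n : ℝ); gcpLaw rate τ] = gcpVarianceRate rate * τ := by
  rw [gcpLaw, variance_map .of_discrete .of_discrete]
  simpa [Function.comp_def, gcpVarianceRate, Finset.sum_mul, mul_assoc] using
    variance_sum_mul_pi_poissonMeasure (fun i : Fin k => (i : ℝ) + 1) (fun i => rate i * τ)

end GCPLaw

namespace IsGCP

variable {Ω : Type*} [MeasurableSpace Ω] {P : Measure Ω} {k : ℕ} {M : ℝ≥0 → Ω → ℕ}
  {rate : Fin k → ℝ≥0}

lemma hasLaw_eval (h : IsGCP M rate P) (t : ℝ≥0) :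
    HasLaw (fun ω => (M t ω : ℝ)) ((gcpLaw rate t).map (Nat.cast : ℕ → ℝ)) P := by
  have law := h.law_increments 0 t zero_le
  rw [tsub_zero] at law
  refine law.congr ?_
  filter_upwards [h.start] with ω hω
  rw [hω, Nat.cast_zero, sub_zero]

lemma memLp_eval (h : IsGCP M rate P) (t : ℝ≥0) : MemLp (fun ω => (M t ω : ℝ)) 2 P := by
  have law := h.hasLaw_eval t
  refine (memLp_map_measure_iff aestronglyMeasurable_id law.aemeasurable).mp ?_
  rw [law.map_eq, memLp_map_measure_iff aestronglyMeasurable_id .of_discrete]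
  exact memLp_natCast_gcpLaw rate t

lemma variance_eval (h : IsGCP M rate P) (t : ℝ≥0) :
    Var[fun ω => (M t ω : ℝ); P] = gcpVarianceRate rate * t := by
  rw [(h.hasLaw_eval t).variance_eq, variance_map aemeasurable_id .of_discrete]
  exact variance_natCast_gcpLaw rate t

lemma aestronglyMeasurable_prod (h : IsGCP M rate P) (ν : Measure ℝ) :
    AEStronglyMeasurable (fun p : Ω × ℝ => (M p.2.toNNReal p.1 : ℝ)) (P.prod ν) := by
  refine (continuous_of_discreteTopology (f := (Nat.cast : ℕ → ℝ))).comp_aestronglyMeasurable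
    (aestronglyMeasurable_prod_of_continuousWithinAt_Ici (X := fun u : ℝ => M u.toNNReal)
      (fun u => h.measurable _) ?_)
  filter_upwards [h.paths] with ω hω u
  exact (hω.2 u.toNNReal).comp continuous_real_toNNReal.continuousWithinAt
    fun v hv => Real.toNNReal_mono hv

lemma memLp_two_prod [SFinite P] (h : IsGCP M rate P) (t : ℝ≥0) :
    MemLp (fun p : Ω × ℝ => (M p.2.toNNReal p.1 : ℝ)) 2
      (P.prod (volume.restrict (Set.Ioc 0 (t : ℝ)))) := by
  refine ((h.memLp_eval t).comp_fst _).mono (h.aestronglyMeasurable_prod _) ?_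
  filter_upwards [Measure.quasiMeasurePreserving_fst.ae h.paths,
    Measure.quasiMeasurePreserving_snd.ae (ae_restrict_mem measurableSet_Ioc)] with p hpath htime
  simp only [Real.norm_natCast, Nat.cast_le]
  exact hpath.1 (Real.toNNReal_le_iff_le_coe.mpr htime.2)

lemma hasMinCovariance [IsProbabilityMeasure P] (h : IsGCP M rate P) :
    HasMinCovariance (fun t ω => (M t ω : ℝ)) (gcpVarianceRate rate) P where
  memLp_two_prod := h.memLp_two_prod
  covariance_eq s t := by
    have start : ∀ᵐ ω ∂P, (M ⊥ ω : ℝ) = 0 := h.start.mono fun ω hω => Nat.cast_eq_zero.mpr hω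
    rw [covariance_eq_variance_min_of_hasIndepIncrements h.indep_increments start h.memLp_eval,
      h.variance_eval]

lemma covariance_eq_zero_of_indepFun {k' : ℕ} {N : ℝ≥0 → Ω → ℕ} {rate' : Fin k' → ℝ≥0}
    (hM : IsGCP M rate P) (hN : IsGCP N rate' P)
    (hMN : IndepFun (fun ω t => M t ω) (fun ω t => N t ω) P) (s t : ℝ≥0) :
    cov[fun ω => (M s ω : ℝ), fun ω => (N t ω : ℝ); P] = 0 :=
  have measurable_cast_eval (u : ℝ≥0) : Measurable fun x : ℝ≥0 → ℕ => (x u : ℝ) := by fun_prop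
  (hMN.comp (measurable_cast_eval s) (measurable_cast_eval t)).covariance_eq_zero
    (hM.memLp_eval s) (hN.memLp_eval t)

end IsGCP

lemma IsGSP.hasMinCovariance {Ω : Type*} [MeasurableSpace Ω] {P : Measure Ω}
    [IsProbabilityMeasure P] {k : ℕ} {S : ℝ≥0 → Ω → ℝ} {rate₁ rate₂ : Fin k → ℝ≥0}
    (h : IsGSP S rate₁ rate₂ P) :
    HasMinCovariance S (gcpVarianceRate rate₁ + gcpVarianceRate rate₂) P := by
  obtain ⟨M₁, M₂, h₁, h₂, hindep, hS⟩ := h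
  obtain rfl : S = fun t ω => (M₁ t ω : ℝ) - M₂ t ω := funext₂ hS
  refine ⟨fun t => (h₁.memLp_two_prod t).sub (h₂.memLp_two_prod t), fun s t => ?_⟩
  rw [covariance_fun_sub_fun_sub (h₁.memLp_eval s) (h₂.memLp_eval s) (h₁.memLp_eval t)
      (h₂.memLp_eval t), h₁.hasMinCovariance.covariance_eq, h₂.hasMinCovariance.covariance_eq,
    h₁.covariance_eq_zero_of_indepFun h₂ hindep, h₂.covariance_eq_zero_of_indepFun h₁ hindep.symm]
  ring

theorem mainTheorem13_general {Ω : Type*} [MeasurableSpace Ω] {P : Measure Ω}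
    [IsProbabilityMeasure P] {X : ℝ≥0 → Ω → ℝ} {κ : ℝ} (h : HasMinCovariance X κ P) (hκ : 0 < κ) :
    (∀ s t : ℝ≥0, 0 < s → s ≤ t →
      corr (runningAverage X s) (runningAverage X t) P =
        (3 * (t : ℝ) - s) / (2 * t) * (√(s : ℝ) * (t : ℝ) ^ (-(1 / 2) : ℝ))) ∧
    HasLRD (runningAverage X) P :=
  ⟨fun _ _ hs hst => h.corr_runningAverage hκ hs hst, h.hasLRD_runningAverage hκ⟩

theorem mainTheorem13 {Ω : Type*} [MeasurableSpace Ω] (P : Measure Ω) [IsProbabilityMeasure P]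
    (k : ℕ) :
    (∀ (S : ℝ≥0 → Ω → ℝ) (rate₁ rate₂ : Fin k → ℝ≥0), IsGSP S rate₁ rate₂ P →
      (∃ i, 0 < rate₁ i ∨ 0 < rate₂ i) →
      (∀ s t : ℝ≥0, 0 < s → s ≤ t →
        corr (runningAverage S s) (runningAverage S t) P =
          (3 * (t : ℝ) - s) / (2 * t) * (√(s : ℝ) * (t : ℝ) ^ (-(1 / 2) : ℝ))) ∧
      HasLRD (runningAverage S) P) ∧
    (∀ (M : ℝ≥0 → Ω → ℕ) (rate : Fin k → ℝ≥0), IsGCP M rate P →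
      (∃ i, 0 < rate i) →
      (∀ s t : ℝ≥0, 0 < s → s ≤ t →
        corr (runningAverage (fun u ω => (M u ω : ℝ)) s)
            (runningAverage (fun u ω => (M u ω : ℝ)) t) P =
          (3 * (t : ℝ) - s) / (2 * t) * (√(s : ℝ) * (t : ℝ) ^ (-(1 / 2) : ℝ))) ∧
      HasLRD (runningAverage fun u ω => (M u ω : ℝ)) P) := by
  refine ⟨fun S rate₁ rate₂ hS hrate => mainTheorem13_general hS.hasMinCovariance ?_,
    fun M rate hM hrate => mainTheorem13_general hM.hasMinCovariance ?_⟩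
  · rcases exists_or.mp hrate with h₁ | h₂
    · exact_mod_cast add_pos_of_pos_of_nonneg (gcpVarianceRate_pos h₁) zero_le
    · exact_mod_cast add_pos_of_nonneg_of_pos zero_le (gcpVarianceRate_pos h₂)
  · exact_mod_cast gcpVarianceRate_pos hrate
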